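/- For $N\ge 1$ let $[N]=\{0,\dots,N-1\}$, and for a probability distribution $D$ on $[N]$ and $S\subseteq[N]$ with $D(S)=\sum_{i\in S}D(i)>0$ let $D_S$ be the conditional distribution: $D_S(i)=D(i)/D(S)$ for $i\in S$ and $D_S(i)=0$ for $i\notin S$. Let $T\ge 1$ be an integer. A $\mathsf{PQCOND}_D$ oracle is given by a mapping $(S,t)\mapsto O_D(S,t)\in[N]$, defined for all $t\in[T]$ and all $S\subseteq[N]$ with $|S|=2$ or $|S|=N$, such that $D_S(i)=|\{t\in[T]:O_D(S,t)=i\}|/T$ for all $i\in[N]$ and all such $S$ with $D(S)>0$ (the values $O_D(S,t)$ are arbitrary if $D(S)=0$). A query to it applies the unitary operation $$|S\rangle|t\rangle|\beta\rangle\ \mapsto\ |S\rangle|t\rangle|\beta+O_D(S,t)\bmod N\rangle .$$ A quantum query algorithm repeatedly runs quantum circuits, which consist of queries and of unitaries that do not depend on $D$ or $O_D$, act on the three query registers and a finite-dimensional workspace, start in a computational basis state and end with a measurement in the computational basis; the choice of the next circuit, or of the final output, may depend on the earlier measurement results. Its number of queries is the maximum over all measurement results. Let $\mathcal A^{(N)}$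 be the uniform distribution on $[N]$ and $|P-Q|=\sum_{i\in[N]}|P(i)-Q(i)|$. **Statement.** There are constants $C$ and $k$ such that for all integers $N,T\ge 1$ and all real $\epsilon>0$ there is a quantum query algorithm that makes at most $$C\cdot\frac1\epsilon\cdot\log^k\!\Big(2+\frac1\epsilon\Big)=\tilde O(1/\epsilon)$$ queries and has the following property. For every probability distribution $D$ on $[N]$ and every $\mathsf{PQCOND}_D$ oracle (with parameter $T$) to which the queries are made, * if $|D-\mathcal A^{(N)}|=0$ (that is, $D=\mathcal A^{(N)}$), then the algorithm outputs "uniform" with probability at least $2/3$; * if $|D-\mathcal A^{(N)}|\ge\epsilon$, then the algorithm outputs "far" with probability at least $2/3$. -/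

import Mathlib

noncomputable section

namespace QuantumTesting

/-- The conditional distribution `D_S` (meaningful when `D(S) > 0`):
`D_S(i) = D(i) / D(S)` for `i ∈ S` and `D_S(i) = 0` for `i ∉ S`. -/
def condDist {N : ℕ} (D : Fin N → ℝ) (S : Finset (Fin N)) (i : Fin N) : ℝ :=
  if i ∈ S then D i / ∑ j ∈ S, D j else 0

/-- The uniform distribution on `[N]`. -/
def uniformDist (N : ℕ) : Fin N → ℝ := fun _ => 1 / (N : ℝ)

/-- The `L₁` distance of two distributions on `[N]`. -/
def l1Dist {N : ℕ} (P Q : Fin N → ℝ) : ℝ := ∑ i, |P i - Q i|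

/-- The query sets that a pairwise oracle accepts: pairs of elements, and the whole set. -/
def pairQueries (N : ℕ) : Finset (Finset (Fin N)) :=
  Finset.univ.filter fun S => S.card = 2 ∨ S.card = N

/-- The mapping `O_D` behind a conditional sampling oracle that accepts the query sets in `𝒬`:
for every accepted `S` with `D(S) > 0`, the frequencies of the labels `O_D(S, t)`, `t ∈ [T]`,
are the probabilities `D_S(i)`. Nothing is said about `O_D(S, ·)` when `D(S) = 0`. -/
structure CondOracle {N : ℕ} (𝒬 : Finset (Finset (Fin N))) (D : Fin N → ℝ) (T : ℕ) where
  label : 𝒬 → Fin T → Fin N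
  freq : ∀ S : 𝒬, 0 < ∑ j ∈ S.1, D j → ∀ i : Fin N,
    condDist D S.1 i = ((Finset.univ.filter fun t : Fin T => label S t = i).card : ℝ) / (T : ℝ)

/-- The data of a `QCOND` oracle for `D`: all query sets are accepted. -/
abbrev QCOND {N : ℕ} (D : Fin N → ℝ) (T : ℕ) := CondOracle (N := N) Finset.univ D T

/-- The data of a `PQCOND` oracle for `D`: only query sets of cardinality `2` or `N`. -/
abbrev PQCOND {N : ℕ} (D : Fin N → ℝ) (T : ℕ) := CondOracle (pairQueries N) D T

/-- Restricting a `QCOND` oracle to the pairwise query sets gives a `PQCOND` oracle. -/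
def QCOND.restrict {N : ℕ} {D : Fin N → ℝ} {T : ℕ} (O : QCOND D T) : PQCOND D T where
  label S t := O.label ⟨S.1, Finset.mem_univ _⟩ t
  freq S hS i := O.freq ⟨S.1, Finset.mem_univ _⟩ hS i

section Machine

variable {N : ℕ} (𝒬 : Finset (Finset (Fin N))) (T : ℕ)

/-- The computational basis states `|S⟩|t⟩|β⟩|w⟩`: a query set, an element of `[T]`, an element of
`[N]` (the output register), and a workspace of dimension `W`. -/
abbrev Register (W : ℕ) : Type := 𝒬 × Fin T × Fin N × Fin W

variable {𝒬 T}

/-- The action of a query on basis states: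
`|S⟩|t⟩|β⟩|w⟩ ↦ |S⟩|t⟩|β + O_D(S, t) mod N⟩|w⟩`. -/
def queryStep {D : Fin N → ℝ} (O : CondOracle 𝒬 D T) (W : ℕ) (r : Register 𝒬 T W) :
    Register 𝒬 T W :=
  (r.1, r.2.1, r.2.2.1 + O.label r.1 r.2.1, r.2.2.2)

theorem queryStep_injective {D : Fin N → ℝ} (O : CondOracle 𝒬 D T) (W : ℕ) :
    Function.Injective (queryStep O W) := by
  rintro ⟨S, t, b, w⟩ ⟨S', t', b', w'⟩ h
  have : NeZero N := ⟨(Fin.pos b).ne'⟩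
  simp only [queryStep, Prod.mk.injEq] at h
  obtain ⟨rfl, rfl, h3, rfl⟩ := h
  rw [add_right_cancel h3]

/-- The matrix of the oracle: its column at the basis state `r` is the basis state
`queryStep O W r`. -/
def queryMatrix {D : Fin N → ℝ} (O : CondOracle 𝒬 D T) (W : ℕ) :
    Matrix (Register 𝒬 T W) (Register 𝒬 T W) ℂ :=
  Matrix.of fun r' r => if r' = queryStep O W r then 1 else 0

theorem queryMatrix_mem_unitaryGroup {D : Fin N → ℝ} (O : CondOracle 𝒬 D T) (W : ℕ) :
    queryMatrix O W ∈ Matrix.unitaryGroup (Register 𝒬 T W) ℂ := by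
  rw [Matrix.mem_unitaryGroup_iff']
  ext a b
  simp [queryMatrix, Matrix.mul_apply, Matrix.star_apply, Matrix.one_apply,
    (queryStep_injective O W).eq_iff, eq_comm]

/-- One query to the oracle, as a unitary operation on the registers. -/
def queryUnitary {D : Fin N → ℝ} (O : CondOracle 𝒬 D T) (W : ℕ) :
    Matrix.unitaryGroup (Register 𝒬 T W) ℂ :=
  ⟨queryMatrix O W, queryMatrix_mem_unitaryGroup O W⟩

variable (𝒬 T) in
/-- A quantum query circuit: it starts in a computational basis state, applies the unitaries
`gate 0`, …, `gate queries` (which do not depend on the oracle), with one query to the oracle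
between any two consecutive ones, and measures all the registers in the computational basis. -/
structure QueryCircuit where
  work : ℕ
  start : Register 𝒬 T work
  queries : ℕ
  gate : ℕ → Matrix.unitaryGroup (Register 𝒬 T work) ℂ

namespace QueryCircuit

/-- The state after `n` queries and the unitary that follows the last of them. -/
def state {D : Fin N → ℝ} (c : QueryCircuit 𝒬 T) (O : CondOracle 𝒬 D T) :
    ℕ → Register 𝒬 T c.work → ℂ
  | 0 => (c.gate 0).1.mulVec (Pi.single c.start 1)
  | n + 1 => (c.gate (n + 1)).1.mulVec ((queryUnitary O c.work).1.mulVec (c.state O n))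

/-- The probability that the final measurement yields the basis state `r`. -/
def outcomeProb {D : Fin N → ℝ} (c : QueryCircuit 𝒬 T) (O : CondOracle 𝒬 D T)
    (r : Register 𝒬 T c.work) : ℝ :=
  ‖c.state O c.queries r‖ ^ 2

end QueryCircuit

variable (𝒬 T) in
/-- A quantum query algorithm with outputs in `α`: it either outputs an answer, or runs a quantum
query circuit and continues in a way that depends on the result of the measurement. -/
inductive QueryAlgorithm (α : Type) : Type
  | answer (a : α) : QueryAlgorithm α
  | run (c : QueryCircuit 𝒬 T) (next : Register 𝒬 T c.work → QueryAlgorithm α) :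
      QueryAlgorithm α

namespace QueryAlgorithm

/-- The largest number of queries that the algorithm makes, over all measurement results. -/
def queries {α : Type} : QueryAlgorithm 𝒬 T α → ℕ
  | answer _ => 0
  | run c next => c.queries + Finset.univ.sup fun r => (next r).queries

/-- The probability that the algorithm outputs `a` when it is given the oracle `O`. -/
def outputProb {α : Type} [DecidableEq α] {D : Fin N → ℝ} (O : CondOracle 𝒬 D T) (a : α) :
    QueryAlgorithm 𝒬 T α → ℝ
  | answer b => if b = a then 1 else 0
  | run c next => ∑ r, c.outcomeProb O r * (next r).outputProb O a

end QueryAlgorithm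

end Machine

/-- The two possible answers of a uniformity test. -/
inductive Verdict
  | uniform
  | far
  deriving DecidableEq

end QuantumTesting

end

/-! The tester compares a sample `i` of `D` with a uniformly random `j` by querying `{i, j}`. The
phase pattern that marks the labels answering `i` averages over `[T]` to the bias `(D j - D i) / (D
j + D i)`. Uncomputing the label turns this bias into an amplitude, so the test succeeds with
probability `p = ∑ D i / N * bias ^ 2` (`exists_pairTest`, `pairTest_prob`).

If `D` is uniform, `p = 0`. In general the distance to uniform is at most the mean of `|D j - D i|`
over `j`, summed over `i`, which equals `2 * ∑ D i / N * |bias|`. Cauchy–Schwarz then gives `p ≥ ε ^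
2 / 4` in the far case (`sq_div_four_le_pairTest_prob`). So the amplitude is at least `ε / 2`.

Writing `p = sin² θ`, each amplification step triples both the angle and the number of queries
(`goodProb_amplify_iterate`). As `θ` is unknown, all powers `3 ^ k` up to order `1 / ε` are tried.
One of them succeeds with probability at least `1 / 4`, and four repetitions suffice. The costs form
a geometric sum, hence `O(1 / ε)` without logarithms. Zero amplitude stays zero, so the error is
one-sided. -/

noncomputable section

namespace QuantumTesting

/-! ### Unitaries on basis states and amplitude amplification -/

section Unitaries

variable {ι κ : Type*} [DecidableEq ι] [Fintype κ]

/-- The vector `∑ x, a x • |f x⟩`. -/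
def superpos (f : κ → ι) (a : κ → ℂ) : ι → ℂ := ∑ x, a x • Pi.single (f x) 1

theorem superpos_apply (f : κ → ι) (a : κ → ℂ) (r : ι) :
    superpos f a r = ∑ x, if r = f x then a x else 0 := by
  simp [superpos, Finset.sum_apply, Pi.single_apply]

variable [Fintype ι]

/-- Distinct indices give distinct basis states, so nothing interferes. -/
theorem sum_normSq_superpos {f : κ → ι} (hf : f.Injective) (a : κ → ℂ) (p : ι → Prop)
    [DecidablePred p] :
    ∑ r, (if p r then ‖superpos f a r‖ ^ 2 else 0) = ∑ x, if p (f x) then ‖a x‖ ^ 2 else 0 := by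
  classical
  have h1 : ∀ x, superpos f a (f x) = a x := fun x => by
    simp [superpos_apply, hf.eq_iff]
  have h2 : ∀ r, r ∉ Finset.univ.image f → superpos f a r = 0 := fun r hr => by
    rw [superpos_apply]
    refine Finset.sum_eq_zero fun x _ => if_neg ?_
    rintro rfl
    simp at hr
  rw [← Finset.sum_subset (Finset.subset_univ (Finset.univ.image f)) fun r _ hr => by simp [h2 r hr],
    Finset.sum_image fun _ _ _ _ h => hf h]
  simp [h1]

theorem mulVec_superpos (M : Matrix ι ι ℂ) (f : κ → ι) (a : κ → ℂ) :
    M.mulVec (superpos f a) = ∑ x, a x • M.mulVec (Pi.single (f x) 1) := by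
  simp only [superpos, ← Matrix.mulVecLin_apply, map_sum, map_smul]

/-- The unitary that permutes the basis states by an injective self-map. -/
def mapUnitary (f : ι → ι) (hf : f.Injective) : Matrix.unitaryGroup ι ℂ :=
  ⟨Matrix.of fun r' r => if r' = f r then 1 else 0, by
    rw [Matrix.mem_unitaryGroup_iff']
    ext a b
    simp [Matrix.mul_apply, Matrix.star_apply, Matrix.one_apply, hf.eq_iff, eq_comm]⟩

theorem mapUnitary_mulVec_single (f : ι → ι) (hf : f.Injective) (r : ι) :
    (mapUnitary f hf).1.mulVec (Pi.single r 1) = Pi.single (f r) 1 := by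
  ext r'
  simp [mapUnitary, Pi.single_apply]

theorem mapUnitary_mulVec_superpos (g : ι → ι) (hg : g.Injective) (f : κ → ι) (a : κ → ℂ) :
    (mapUnitary g hg).1.mulVec (superpos f a) = superpos (g ∘ f) a := by
  rw [mulVec_superpos]
  simp only [mapUnitary_mulVec_single, superpos, Function.comp]

theorem star_mapUnitary {f g : ι → ι} (hf : f.Injective) (hg : g.Injective)
    (h : ∀ r, g (f r) = r) : star (mapUnitary f hf) = mapUnitary g hg := by
  refine (eq_inv_of_mul_eq_one_left ?_).symm
  ext a b
  simp [mapUnitary, Matrix.mul_apply, Matrix.one_apply, h]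

theorem mapUnitary_mul {f g : ι → ι} (hf : f.Injective) (hg : g.Injective) :
    mapUnitary f hf * mapUnitary g hg = mapUnitary (f ∘ g) (hf.comp hg) := by
  ext a b
  simp [mapUnitary, Matrix.mul_apply]

/-- The diagonal unitary that flips the sign of the basis states satisfying `p`. -/
def signUnitary (p : ι → Prop) [DecidablePred p] : Matrix.unitaryGroup ι ℂ :=
  ⟨Matrix.diagonal fun r => if p r then -1 else 1, by
    rw [Matrix.mem_unitaryGroup_iff', Matrix.star_eq_conjTranspose, Matrix.diagonal_conjTranspose,
      Matrix.diagonal_mul_diagonal, ← Matrix.diagonal_one]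
    congr 1
    ext r
    by_cases h : p r <;> simp [h]⟩

theorem signUnitary_mulVec (p : ι → Prop) [DecidablePred p] (v : ι → ℂ) (r : ι) :
    (signUnitary p).1.mulVec v r = if p r then -v r else v r := by
  simp [signUnitary, Matrix.mulVec_diagonal]

theorem signUnitary_mulVec_superpos (p : ι → Prop) [DecidablePred p] (f : κ → ι) (a : κ → ℂ) :
    (signUnitary p).1.mulVec (superpos f a) =
      superpos f fun x => if p (f x) then -a x else a x := by
  ext r
  rw [signUnitary_mulVec, superpos_apply, superpos_apply, ← Finset.sum_neg_distrib]
  split_ifs with h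
  · refine Finset.sum_congr rfl fun x _ => ?_
    split_ifs <;> simp_all
  · refine Finset.sum_congr rfl fun x _ => ?_
    split_ifs <;> simp_all

/-- Every unit vector is a column of a unitary matrix. -/
theorem exists_unitary_col (s : ι) (u : ι → ℂ) (hu : ∑ r, ‖u r‖ ^ 2 = 1) :
    ∃ U : Matrix.unitaryGroup ι ℂ, ∀ r, U.1 r s = u r := by
  let v : ι → EuclideanSpace ℂ ι := fun _ => WithLp.toLp 2 u
  have hv : Orthonormal ℂ (({s} : Set ι).domRestrict v) := by
    constructor
    · intro i
      have : ‖v s‖ ^ 2 = 1 := by rw [EuclideanSpace.norm_sq_eq]; exact hu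
      have h2 : ‖v s‖ = 1 := by
        nlinarith [norm_nonneg (v s)]
      exact h2
    · intro i j hij
      exact absurd (Subsingleton.elim i j) hij
  obtain ⟨b, hb⟩ := hv.exists_orthonormalBasis_extension_of_card_eq (by simp)
  refine ⟨⟨(EuclideanSpace.basisFun ι ℂ).toBasis.toMatrix b,
    OrthonormalBasis.toMatrix_orthonormalBasis_mem_unitary _ _⟩, fun r => ?_⟩
  simp [Module.Basis.toMatrix_apply, hb s rfl, v]

theorem unitary_sum_normSq_col (U : Matrix.unitaryGroup ι ℂ) (s : ι) :
    ∑ r, ‖U.1 r s‖ ^ 2 = 1 := by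
  have h := congrFun (congrFun (Matrix.mem_unitaryGroup_iff'.1 U.2) s) s
  rw [Matrix.mul_apply, Matrix.one_apply_eq] at h
  have h' : ((∑ r, ‖U.1 r s‖ ^ 2 : ℝ) : ℂ) = 1 := by
    rw [← h]
    push_cast
    refine Finset.sum_congr rfl fun r _ => ?_
    rw [Matrix.star_apply, ← Complex.conj_mul']
    rfl
  exact_mod_cast h'

/-- The probability that measuring the state `U|s⟩` gives a basis state satisfying `good`. -/
def goodProb (s : ι) (good : ι → Prop) [DecidablePred good] (U : Matrix.unitaryGroup ι ℂ) : ℝ :=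
  ∑ r, if good r then ‖U.1 r s‖ ^ 2 else 0

/-- One step of amplitude amplification. -/
def amplify (s : ι) (good : ι → Prop) [DecidablePred good] (U : Matrix.unitaryGroup ι ℂ) :
    Matrix.unitaryGroup ι ℂ :=
  U * signUnitary (· = s) * star U * signUnitary good * U

theorem goodProb_nonneg (s : ι) (good : ι → Prop) [DecidablePred good]
    (U : Matrix.unitaryGroup ι ℂ) : 0 ≤ goodProb s good U :=
  Finset.sum_nonneg fun r _ => by split_ifs <;> positivity

theorem goodProb_le_one (s : ι) (good : ι → Prop) [DecidablePred good]
    (U : Matrix.unitaryGroup ι ℂ) : goodProb s good U ≤ 1 := by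
  rw [← unitary_sum_normSq_col U s]
  refine Finset.sum_le_sum fun r _ => ?_
  split_ifs
  · exact le_rfl
  · positivity

/-- Conjugated by `U`, the sign flip at `s` is the reflection `y ↦ y - 2⟨u, y⟩u` with `u = U|s⟩`.
For `y` equal to `u` with its good part negated, `⟨u, y⟩ = 1 - 2p`, where `p` is the good
probability. A good coordinate is thus scaled by `-1 - 2(1 - 2p) = 4p - 3`. -/
theorem amplify_apply (s : ι) (good : ι → Prop) [DecidablePred good]
    (U : Matrix.unitaryGroup ι ℂ) (r : ι) (hr : good r) :
    (amplify s good U).1 r s = ((4 * goodProb s good U - 3 : ℝ) : ℂ) * U.1 r s := by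
  set y : ι → ℂ := fun r => if good r then -U.1 r s else U.1 r s with hy
  set z : ι → ℂ := (star U).1.mulVec y with hz
  have hzs : z s = ((1 - 2 * goodProb s good U : ℝ) : ℂ) := by
    rw [← unitary_sum_normSq_col U s, goodProb, Finset.mul_sum, ← Finset.sum_sub_distrib, hz]
    simp only [Matrix.mulVec, dotProduct, Complex.ofReal_sum]
    refine Finset.sum_congr rfl fun r _ => ?_
    have : (star U).1 s r = (starRingEnd ℂ) (U.1 r s) := rfl
    have hn := Complex.conj_mul' (U.1 r s)
    rw [this, hy]
    by_cases h : good r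
    · simp only [h, if_true]
      push_cast
      linear_combination -hn
    · simp only [h, if_false]
      push_cast
      linear_combination hn
  have hsign : (signUnitary (· = s)).1.mulVec z = z - (2 * z s) • Pi.single s 1 := by
    ext r
    rw [signUnitary_mulVec]
    by_cases h : r = s
    · subst h
      simp
      ring
    · simp [h]
  have hUz : U.1.mulVec z = y := by
    rw [hz, Matrix.mulVec_mulVec]
    have : U.1 * (star U).1 = 1 := Matrix.mem_unitaryGroup_iff.1 U.2
    rw [this, Matrix.one_mulVec]
  have hcol : ∀ (A : Matrix ι ι ℂ) r, A r s = A.mulVec (Pi.single s 1) r := by simp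
  have hy' : (signUnitary good).1.mulVec (U.1.mulVec (Pi.single s 1)) = y := by
    ext r
    rw [signUnitary_mulVec, ← hcol]
  have : (amplify s good U).1.mulVec (Pi.single s 1) = y - (2 * z s) • U.1.mulVec (Pi.single s 1) := by
    have : (amplify s good U).1 =
      U.1 * (signUnitary (· = s)).1 * (star U).1 * (signUnitary good).1 * U.1 := rfl
    rw [this]
    simp only [← Matrix.mulVec_mulVec]
    rw [hy', ← hz, hsign, Matrix.mulVec_sub, hUz, Matrix.mulVec_smul]
  rw [hcol (amplify s good U).1, this, Pi.sub_apply, Pi.smul_apply, ← hcol, hzs, hy]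
  simp only [hr, if_true, smul_eq_mul]
  push_cast
  ring

theorem goodProb_amplify (s : ι) (good : ι → Prop) [DecidablePred good]
    (U : Matrix.unitaryGroup ι ℂ) :
    goodProb s good (amplify s good U) =
      (3 - 4 * goodProb s good U) ^ 2 * goodProb s good U := by
  conv_rhs => rw [goodProb, Finset.mul_sum]
  rw [goodProb]
  refine Finset.sum_congr rfl fun r _ => ?_
  split_ifs with h
  · rw [amplify_apply s good U r h, norm_mul, mul_pow, Complex.norm_real, Real.norm_eq_abs, sq_abs]
    rw [← goodProb]
    ring
  · simp

/-- The recursion `p ↦ (3 - 4p)² p` is the triple-angle formula for `sin²`. Each step amplifies the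
already amplified unitary. -/
theorem goodProb_amplify_iterate (s : ι) (good : ι → Prop) [DecidablePred good]
    (U : Matrix.unitaryGroup ι ℂ) {θ : ℝ} (hθ : goodProb s good U = Real.sin θ ^ 2) (k : ℕ) :
    goodProb s good ((amplify s good)^[k] U) = Real.sin (3 ^ k * θ) ^ 2 := by
  induction k with
  | zero => simpa using hθ
  | succ k ih =>
    rw [Function.iterate_succ_apply', goodProb_amplify, ih, pow_succ (3 : ℝ), mul_comm _ (3 : ℝ), mul_assoc 3,
      Real.sin_three_mul]
    ring

/-- Amplification reaches a constant probability after logarithmically many steps. -/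
theorem exists_goodProb_amplify_iterate (s : ι) (good : ι → Prop) [DecidablePred good]
    (U : Matrix.unitaryGroup ι ℂ) {ε : ℝ} (hε : 0 < ε) (hU : ε ^ 2 / 4 ≤ goodProb s good U)
    {K : ℕ} (hK : 2 ≤ 3 ^ K * ε) :
    ∃ k ≤ K, 1 / 4 ≤ goodProb s good ((amplify s good)^[k] U) := by
  have h0 := goodProb_nonneg s good U
  set a := Real.sqrt (goodProb s good U) with ha
  have ha1 : a ≤ 1 := Real.sqrt_le_one.2 (goodProb_le_one s good U)
  have haε : ε / 2 ≤ a := Real.le_sqrt_of_sq_le (by linarith [hU, div_pow ε 2 2])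
  set θ := Real.arcsin a
  have hsin : Real.sin θ = a := Real.sin_arcsin (by linarith) ha1
  have hθ : goodProb s good U = Real.sin θ ^ 2 := by rw [hsin, ha, Real.sq_sqrt h0]
  have hθ0 : 0 < θ := Real.arcsin_pos.2 (by linarith)
  have hθa : a ≤ θ := hsin ▸ Real.sin_le hθ0.le
  have hθ2 : θ ≤ Real.pi / 2 := Real.arcsin_le_pi_div_two a
  have hpi := Real.pi_le_four
  have hKθ : Real.pi / 6 ≤ 3 ^ K * θ := by
    have : (3 : ℝ) ^ K * (ε / 2) ≤ 3 ^ K * θ := by gcongr; linarith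
    linarith
  classical
  -- For the first `k` with `3 ^ k * θ ≥ π / 6`, the previous angle is below `π / 6`. The angle
  -- therefore stays within `π / 2`, where the sine is still at least `1 / 2`.
  have hex : ∃ k, Real.pi / 6 ≤ 3 ^ k * θ := ⟨K, hKθ⟩
  refine ⟨Nat.find hex, Nat.find_min' hex hKθ, ?_⟩
  rw [goodProb_amplify_iterate s good U hθ]
  have hlow := Nat.find_spec hex
  have hhigh : 3 ^ Nat.find hex * θ ≤ Real.pi / 2 := by
    rcases hk : Nat.find hex with _ | k
    · simpa using hθ2
    · have := Nat.find_min hex (m := k) (by omega)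
      rw [pow_succ]
      linarith
  have := Real.sin_le_sin_of_le_of_le_pi_div_two (by linarith [Real.pi_pos]) hhigh hlow
  rw [Real.sin_pi_div_six] at this
  nlinarith

end Unitaries

/-! ### Query cost of products, inverses and amplification -/

section Circuits

variable {N : ℕ} {𝒬 : Finset (Finset (Fin N))} {T W : ℕ}

/-- The unitary of a circuit with the given gates and `n` queries. -/
def circuitUnitary {D : Fin N → ℝ} (O : CondOracle 𝒬 D T)
    (gate : ℕ → Matrix.unitaryGroup (Register 𝒬 T W) ℂ) :
    ℕ → Matrix.unitaryGroup (Register 𝒬 T W) ℂ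
  | 0 => gate 0
  | n + 1 => gate (n + 1) * (queryUnitary O W * circuitUnitary O gate n)

theorem circuitUnitary_congr {D : Fin N → ℝ} (O : CondOracle 𝒬 D T)
    {g g' : ℕ → Matrix.unitaryGroup (Register 𝒬 T W) ℂ} {n : ℕ} (h : ∀ i ≤ n, g i = g' i) :
    circuitUnitary O g n = circuitUnitary O g' n := by
  induction n with
  | zero => exact h 0 le_rfl
  | succ n ih =>
    rw [circuitUnitary, circuitUnitary, ih fun i hi => h i (by omega), h (n + 1) le_rfl]

theorem QueryCircuit.state_eq {D : Fin N → ℝ} (O : CondOracle 𝒬 D T)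
    (start : Register 𝒬 T W) (q n : ℕ) (gate : ℕ → Matrix.unitaryGroup (Register 𝒬 T W) ℂ) :
    (QueryCircuit.mk W start q gate).state O n =
      (circuitUnitary O gate n).1.mulVec (Pi.single start 1) := by
  induction n with
  | zero => rfl
  | succ n ih =>
    have : (circuitUnitary O gate (n + 1)).1 =
      (gate (n + 1)).1 * ((queryUnitary O W).1 * (circuitUnitary O gate n).1) := rfl
    rw [QueryCircuit.state, ih, this, ← Matrix.mulVec_mulVec, ← Matrix.mulVec_mulVec]

/-- A family of unitaries, indexed by oracles, is implementable with `n` queries. -/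
def Implementable (n : ℕ)
    (V : ∀ D : Fin N → ℝ, CondOracle 𝒬 D T → Matrix.unitaryGroup (Register 𝒬 T W) ℂ) : Prop :=
  ∃ gate, ∀ D O, V D O = circuitUnitary O gate n

namespace Implementable

variable {m n : ℕ}
  {U V : ∀ D : Fin N → ℝ, CondOracle 𝒬 D T → Matrix.unitaryGroup (Register 𝒬 T W) ℂ}

theorem const (G : Matrix.unitaryGroup (Register 𝒬 T W) ℂ) :
    Implementable (𝒬 := 𝒬) (T := T) 0 fun _ _ => G :=
  ⟨fun _ => G, fun _ _ => rfl⟩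

theorem gate_mul (G : Matrix.unitaryGroup (Register 𝒬 T W) ℂ) (h : Implementable n V) :
    Implementable n fun D O => G * V D O := by
  obtain ⟨g, hg⟩ := h
  refine ⟨Function.update g n (G * g n), fun D O => ?_⟩
  cases n with
  | zero => simp [hg, circuitUnitary]
  | succ n =>
    simp only [hg]
    rw [circuitUnitary, circuitUnitary, Function.update_self, mul_assoc]
    congr 2
    congr 1
    refine circuitUnitary_congr O fun i hi => ?_
    rw [Function.update_of_ne (by omega)]

theorem query_mul (h : Implementable n V) :
    Implementable (n + 1) fun D O => queryUnitary O W * V D O := by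
  obtain ⟨g, hg⟩ := h
  refine ⟨Function.update g (n + 1) 1, fun D O => ?_⟩
  simp only [hg]
  rw [circuitUnitary, Function.update_self, one_mul]
  congr 1
  refine circuitUnitary_congr O fun i hi => ?_
  rw [Function.update_of_ne (by omega)]

/-- The first gate of `U` merges with the last gate of `V`, so only queries are counted. -/
theorem mul (hU : Implementable m U) (hV : Implementable n V) :
    Implementable (m + n) fun D O => U D O * V D O := by
  obtain ⟨g, hg⟩ := hU
  simp only [hg]
  clear hg
  induction m with
  | zero => simpa [circuitUnitary] using gate_mul (g 0) hV
  | succ m ih =>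
    simp only [circuitUnitary, mul_assoc]
    rw [show m + 1 + n = m + n + 1 by omega]
    exact gate_mul _ (query_mul ih)

theorem query : Implementable 1 fun (D : Fin N → ℝ) (O : CondOracle 𝒬 D T) => queryUnitary O W := by
  simpa using query_mul (const (𝒬 := 𝒬) (T := T) (W := W) 1)

end Implementable

/-- Negation of the output register. -/
def negOutput (r : Register 𝒬 T W) : Register 𝒬 T W := (r.1, r.2.1, -r.2.2.1, r.2.2.2)

/-- The inverse of a query on basis states. -/
def unqueryStep {D : Fin N → ℝ} (O : CondOracle 𝒬 D T) (W : ℕ) (r : Register 𝒬 T W) :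
    Register 𝒬 T W :=
  (r.1, r.2.1, r.2.2.1 - O.label r.1 r.2.1, r.2.2.2)

theorem negOutput_injective : (negOutput (𝒬 := 𝒬) (T := T) (W := W)).Injective := by
  rintro ⟨S, t, b, w⟩ ⟨S', t', b', w'⟩ h
  simp only [negOutput, Prod.mk.injEq] at h
  obtain ⟨rfl, rfl, h3, rfl⟩ := h
  rw [neg_injective h3]

theorem queryUnitary_eq {D : Fin N → ℝ} (O : CondOracle 𝒬 D T) (W : ℕ) :
    queryUnitary O W = mapUnitary (queryStep O W) (queryStep_injective O W) := rfl

variable [NeZero N]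

theorem unqueryStep_injective {D : Fin N → ℝ} (O : CondOracle 𝒬 D T) (W : ℕ) :
    (unqueryStep O W).Injective := by
  rintro ⟨S, t, b, w⟩ ⟨S', t', b', w'⟩ h
  simp only [unqueryStep, Prod.mk.injEq] at h
  obtain ⟨rfl, rfl, h3, rfl⟩ := h
  rw [sub_left_injective h3]

theorem star_queryUnitary {D : Fin N → ℝ} (O : CondOracle 𝒬 D T) (W : ℕ) :
    star (queryUnitary O W) = mapUnitary (unqueryStep O W) (unqueryStep_injective O W) :=
  star_mapUnitary (queryStep_injective O W) _ fun r => by simp [queryStep, unqueryStep]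

/-- Since `-(-b + l) = b - l`, negating the output register before and after a query undoes a query.
An inverse query thus costs one query. -/
theorem star_queryUnitary_eq_conj {D : Fin N → ℝ} (O : CondOracle 𝒬 D T) (W : ℕ) :
    star (queryUnitary O W) =
      mapUnitary negOutput negOutput_injective *
        (queryUnitary O W * mapUnitary negOutput negOutput_injective) := by
  rw [queryUnitary_eq, mapUnitary_mul, mapUnitary_mul]
  exact star_mapUnitary _ _ fun r => by simp [queryStep, negOutput]

namespace Implementable

variable {m n : ℕ}
  {V : ∀ D : Fin N → ℝ, CondOracle 𝒬 D T → Matrix.unitaryGroup (Register 𝒬 T W) ℂ}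

theorem star_query :
    Implementable 1 fun (D : Fin N → ℝ) (O : CondOracle 𝒬 D T) => star (queryUnitary O W) := by
  simp only [star_queryUnitary_eq_conj]
  exact gate_mul _ (query_mul (const _))

theorem star (hV : Implementable n V) : Implementable n fun D O => star (V D O) := by
  obtain ⟨g, hg⟩ := hV
  simp only [hg]
  clear hg
  induction n with
  | zero => exact const (Star.star (g 0))
  | succ n ih =>
    simp only [circuitUnitary, star_mul]
    simpa using (ih.mul star_query).mul (const (Star.star (g (n + 1))))

theorem amplify (s : Register 𝒬 T W) (good : Register 𝒬 T W → Prop) [DecidablePred good]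
    (hV : Implementable n V) :
    Implementable (3 * n) fun D O => QuantumTesting.amplify s good (V D O) := by
  have := (((hV.mul (const _)).mul hV.star).mul (const (signUnitary good))).mul hV
    (m := n + 0 + n + 0) (U := fun D O => V D O * signUnitary (· = s) * Star.star (V D O) * signUnitary good)
  rw [show 3 * n = n + 0 + n + 0 + n by omega]
  exact this

theorem amplify_iterate (s : Register 𝒬 T W) (good : Register 𝒬 T W → Prop) [DecidablePred good]
    (hV : Implementable n V) (k : ℕ) :
    Implementable (3 ^ k * n) fun D O => (QuantumTesting.amplify s good)^[k] (V D O) := by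
  induction k with
  | zero => simpa using hV
  | succ k ih =>
    simp only [Function.iterate_succ_apply']
    rw [show 3 ^ (k + 1) * n = 3 * (3 ^ k * n) by ring]
    exact ih.amplify s good

end Implementable

end Circuits

/-! ### Repeated trials with one-sided error -/

section Detection

variable {N : ℕ} {𝒬 : Finset (Finset (Fin N))} {T W : ℕ}

/-- Run the given circuits (a number of queries and the gates) one after the other, and answer `far`
as soon as a measurement result satisfies `good`. -/
def detect (s : Register 𝒬 T W) (good : Register 𝒬 T W → Prop) [DecidablePred good] :
    List (ℕ × (ℕ → Matrix.unitaryGroup (Register 𝒬 T W) ℂ)) → QueryAlgorithm 𝒬 T Verdict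
  | [] => .answer .uniform
  | c :: l => .run ⟨W, s, c.1, c.2⟩ fun r => if good r then .answer .far else detect s good l

theorem detect_queries (s : Register 𝒬 T W) (good : Register 𝒬 T W → Prop) [DecidablePred good]
    (l : List (ℕ × (ℕ → Matrix.unitaryGroup (Register 𝒬 T W) ℂ))) :
    (detect s good l).queries ≤ (l.map Prod.fst).sum := by
  induction l with
  | nil => simp [detect, QueryAlgorithm.queries]
  | cons c l ih =>
    simp only [detect, QueryAlgorithm.queries, List.map_cons, List.sum_cons]
    refine Nat.add_le_add_left (Finset.sup_le fun r _ => ?_) _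
    split_ifs
    · simp [QueryAlgorithm.queries]
    · exact ih

/-- The probability that none of the measurement results satisfies `good`. -/
def missProb {D : Fin N → ℝ} (O : CondOracle 𝒬 D T) (s : Register 𝒬 T W)
    (good : Register 𝒬 T W → Prop) [DecidablePred good]
    (l : List (ℕ × (ℕ → Matrix.unitaryGroup (Register 𝒬 T W) ℂ))) : ℝ :=
  (l.map fun c => 1 - goodProb s good (circuitUnitary O c.2 c.1)).prod

theorem detect_outputProb {D : Fin N → ℝ} (O : CondOracle 𝒬 D T) (s : Register 𝒬 T W)
    (good : Register 𝒬 T W → Prop) [DecidablePred good]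
    (l : List (ℕ × (ℕ → Matrix.unitaryGroup (Register 𝒬 T W) ℂ))) :
    (detect s good l).outputProb O .uniform = missProb O s good l ∧
      (detect s good l).outputProb O .far = 1 - missProb O s good l := by
  induction l with
  | nil => simp [detect, QueryAlgorithm.outputProb, missProb]
  | cons c l ih =>
    have hout : ∀ r, (QueryCircuit.mk W s c.1 c.2).outcomeProb O r =
        ‖(circuitUnitary O c.2 c.1).1 r s‖ ^ 2 := fun r => by
      rw [QueryCircuit.outcomeProb, QueryCircuit.state_eq]
      simp
    have hsum := unitary_sum_normSq_col (circuitUnitary O c.2 c.1) s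
    have hmiss : missProb O s good (c :: l) =
      (1 - goodProb s good (circuitUnitary O c.2 c.1)) * missProb O s good l := by simp [missProb]
    have key : ∀ x y : ℝ,
        ∑ r, ‖(circuitUnitary O c.2 c.1).1 r s‖ ^ 2 * (if good r then x else y) =
          y + (x - y) * goodProb s good (circuitUnitary O c.2 c.1) := by
      intro x y
      have hy : y = ∑ r, ‖(circuitUnitary O c.2 c.1).1 r s‖ ^ 2 * y := by
        rw [← Finset.sum_mul, hsum, one_mul]
      conv_rhs => rw [goodProb, Finset.mul_sum]
      nth_rw 2 [hy]
      rw [← Finset.sum_add_distrib]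
      refine Finset.sum_congr rfl fun r _ => ?_
      split_ifs <;> ring
    have hrun : ∀ v, (detect s good (c :: l)).outputProb O v =
        ∑ r, ‖(circuitUnitary O c.2 c.1).1 r s‖ ^ 2 *
          (if good r then (if Verdict.far = v then 1 else 0)
            else (detect s good l).outputProb O v) := fun v => by
      simp only [detect, QueryAlgorithm.outputProb]
      refine Finset.sum_congr rfl fun r _ => ?_
      rw [hout]
      split_ifs <;> simp_all [QueryAlgorithm.outputProb]
    rw [hrun, hrun, key, key, ih.1, ih.2, hmiss]
    constructor
    · simp
      ring
    · simp
      ring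

end Detection

/-! ### The pair test as a three-query circuit -/

section PairTest

variable {N T : ℕ}

theorem univ_mem_pairQueries (N : ℕ) : (Finset.univ : Finset (Fin N)) ∈ pairQueries N := by
  simp [pairQueries]

/-- The query set `{i, j}`, or the whole set if `i = j`. -/
def pairSet (i j : Fin N) : pairQueries N :=
  if h : i = j then ⟨Finset.univ, univ_mem_pairQueries N⟩
  else ⟨{i, j}, by simp [pairQueries, Finset.card_pair h]⟩

/-- The dimension of a workspace that holds an element of `[T]` and two elements of `[N]`. -/
def workDim (N T : ℕ) : ℕ := Fintype.card (Fin T × Fin N × Fin N)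

/-- The basis states of the workspace. -/
def workEquiv (N T : ℕ) : Fin T × Fin N × Fin N ≃ Fin (workDim N T) := Fintype.equivFin _

/-- The registers of the pair test. -/
abbrev PairRegister (N T : ℕ) : Type := Register (pairQueries N) T (workDim N T)

/-- The basis state `|S⟩|t⟩|b⟩|t', x, j⟩`. -/
def ket (S : pairQueries N) (t : Fin T) (b : Fin N) (t' : Fin T) (x j : Fin N) :
    PairRegister N T := (S, t, b, workEquiv N T (t', x, j))

/-- Exchange the query registers with the workspace, and then the whole set with `{x, j}`, where
`x` and `j` are the elements of `[N]` in the workspace. -/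
def loadPair (r : PairRegister N T) : PairRegister N T :=
  let w := (workEquiv N T).symm r.2.2.2
  ket (Equiv.swap ⟨Finset.univ, univ_mem_pairQueries N⟩ (pairSet r.2.2.1 w.2.2) r.1)
    w.1 w.2.1 r.2.1 r.2.2.1 w.2.2

/-- The swap of query sets depends only on two elements of `[N]` that survive in the workspace, so
it can be undone. -/
theorem loadPair_injective : (loadPair (N := N) (T := T)).Injective := by
  rintro ⟨S, t, b, w⟩ ⟨S', t', b', w'⟩ h
  obtain ⟨⟨t₁, x, j⟩, rfl⟩ := (workEquiv N T).surjective w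
  obtain ⟨⟨t₁', x', j'⟩, rfl⟩ := (workEquiv N T).surjective w'
  simp only [loadPair, ket, Equiv.symm_apply_apply, Prod.mk.injEq,
    EmbeddingLike.apply_eq_iff_eq] at h
  obtain ⟨h1, rfl, rfl, rfl, rfl, rfl⟩ := h
  rw [(Equiv.injective _) h1]

theorem loadPair_ket (t t' : Fin T) (b x j : Fin N) :
    loadPair (ket ⟨Finset.univ, univ_mem_pairQueries N⟩ t b t' x j) =
      ket (pairSet b j) t' x t b j := by
  simp [loadPair, ket]

/-- The first element of `[N]` in the workspace. -/
def fstWork (r : PairRegister N T) : Fin N := ((workEquiv N T).symm r.2.2.2).2.1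

/-- The second element of `[N]` in the workspace. -/
def sndWork (r : PairRegister N T) : Fin N := ((workEquiv N T).symm r.2.2.2).2.2

theorem fstWork_ket (S : pairQueries N) (t t' : Fin T) (b x j : Fin N) :
    fstWork (ket S t b t' x j) = x := by simp [fstWork, ket]

theorem sndWork_ket (S : pairQueries N) (t t' : Fin T) (b x j : Fin N) :
    sndWork (ket S t b t' x j) = j := by simp [sndWork, ket]

theorem ket_inj {S S' : pairQueries N} {t u t' u' : Fin T} {b x j b' x' j' : Fin N} :
    ket S t b t' x j = ket S' u b' u' x' j' ↔
      S = S' ∧ t = u ∧ b = b' ∧ t' = u' ∧ x = x' ∧ j = j' := by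
  simp [ket]

theorem queryStep_ket {D : Fin N → ℝ} (O : PQCOND D T) (S : pairQueries N) (t t' : Fin T)
    (b x j : Fin N) :
    queryStep O (workDim N T) (ket S t b t' x j) = ket S t (b + O.label S t) t' x j := rfl

theorem unqueryStep_ket {D : Fin N → ℝ} (O : PQCOND D T) (S : pairQueries N) (t t' : Fin T)
    (b x j : Fin N) :
    unqueryStep O (workDim N T) (ket S t b t' x j) = ket S t (b - O.label S t) t' x j := rfl

/-- A unitary on the register `[T]`, as a unitary on all registers. -/
def labelUnitary (A : Matrix.unitaryGroup (Fin T) ℂ) :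
    Matrix.unitaryGroup (PairRegister N T) ℂ :=
  ⟨Matrix.of fun r r' => if r.1 = r'.1 ∧ r.2.2 = r'.2.2 then A.1 r.2.1 r'.2.1 else 0, by
    rw [Matrix.mem_unitaryGroup_iff']
    ext ⟨S, t, w⟩ ⟨S', t', w'⟩
    have h := congrFun (congrFun (Matrix.mem_unitaryGroup_iff'.1 A.2) t) t'
    simp only [Matrix.mul_apply, Matrix.star_apply, Matrix.of_apply] at h ⊢
    simp only [Fintype.sum_prod_type (α₁ := pairQueries N),
      Fintype.sum_prod_type (α₁ := Fin T) (α₂ := Fin N × Fin (workDim N T))]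
    by_cases hS : S = S' ∧ w = w'
    · obtain ⟨rfl, rfl⟩ := hS
      rw [Finset.sum_eq_single S, Finset.sum_congr rfl fun u _ => Finset.sum_eq_single w ?_ ?_]
      · simpa [Matrix.one_apply] using h
      all_goals simp +contextual
    · have : ((S, t, w) : PairRegister N T) ≠ (S', t', w') := by
        intro h
        simp only [Prod.mk.injEq] at h
        exact hS ⟨h.1, h.2.2⟩
      rw [Matrix.one_apply_ne this]
      refine Finset.sum_eq_zero fun S₁ _ => Finset.sum_eq_zero fun t₁ _ =>
        Finset.sum_eq_zero fun w₁ _ => ?_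
      by_cases h1 : S₁ = S ∧ w₁ = w
      · obtain ⟨rfl, rfl⟩ := h1
        simp [hS]
      · simp [h1]⟩

theorem labelUnitary_mulVec_superpos {κ : Type*} [Fintype κ] (A : Matrix.unitaryGroup (Fin T) ℂ)
    (f : κ → PairRegister N T) (a : κ → ℂ) (r : PairRegister N T) :
    (labelUnitary A).1.mulVec (superpos f a) r =
      ∑ x, if r.1 = (f x).1 ∧ r.2.2 = (f x).2.2 then a x * A.1 r.2.1 (f x).2.1 else 0 := by
  rw [mulVec_superpos, Finset.sum_apply]
  refine Finset.sum_congr rfl fun x _ => ?_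
  simp [labelUnitary]

/-- It is a row that is uniform: after `A`, the amplitude of label `0` is the sum of all label
amplitudes divided by `√T`. This is how the bias becomes an amplitude. -/
theorem exists_uniform_unitary (T : ℕ) [NeZero T] :
    ∃ A : Matrix.unitaryGroup (Fin T) ℂ, ∀ t, A.1 0 t = ((1 / √T : ℝ) : ℂ) := by
  have hT : (0 : ℝ) < T := Nat.cast_pos.2 (NeZero.pos T)
  obtain ⟨U, hU⟩ := exists_unitary_col (0 : Fin T) (fun _ => ((1 / √T : ℝ) : ℂ)) (by
    simp only [Complex.norm_real, Real.norm_eq_abs, sq_abs, div_pow, Real.sq_sqrt hT.le]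
    simp [hT.ne'])
  refine ⟨star U, fun t => ?_⟩
  have : (star U).1 0 t = (starRingEnd ℂ) (U.1 t 0) := rfl
  rw [this, hU, Complex.conj_ofReal]

variable [NeZero N]

/-- The basis states that occur in the initial superposition of the pair test. -/
def pairInit (x : (Fin T × Fin N) × Fin T) : PairRegister N T :=
  ket ⟨Finset.univ, univ_mem_pairQueries N⟩ x.1.1 0 x.2 0 x.1.2

theorem pairInit_injective : (pairInit (N := N) (T := T)).Injective := by
  rintro ⟨⟨t, j⟩, t'⟩ ⟨⟨u, j'⟩, u'⟩ h
  rw [pairInit, pairInit, ket_inj] at h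
  obtain ⟨-, h1, -, h2, -, h3⟩ := h
  simp_all

variable [NeZero T]

variable (N T) in
/-- The initial basis state of the pair test. -/
def pairStart : PairRegister N T := ket ⟨Finset.univ, univ_mem_pairQueries N⟩ 0 0 0 0 0

variable (N T) in
theorem exists_pairInit_unitary :
    ∃ U : Matrix.unitaryGroup (PairRegister N T) ℂ,
      U.1.mulVec (Pi.single (pairStart N T) 1) =
        superpos pairInit fun _ => ((1 / (√(T * N) * √T) : ℝ) : ℂ) := by
  have hT : (0 : ℝ) < T := Nat.cast_pos.2 (NeZero.pos T)
  have hN : (0 : ℝ) < N := Nat.cast_pos.2 (NeZero.pos N)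
  obtain ⟨U, hU⟩ := exists_unitary_col (pairStart N T)
    (superpos pairInit fun _ => ((1 / (√(T * N) * √T) : ℝ) : ℂ)) (by
      have := sum_normSq_superpos pairInit_injective
        (fun _ => ((1 / (√(T * N) * √T) : ℝ) : ℂ)) (fun _ : PairRegister N T => True)
      simp only [if_true] at this
      rw [this]
      simp only [Complex.norm_real, Real.norm_eq_abs, sq_abs, div_pow, mul_pow,
        Real.sq_sqrt hT.le, Real.sq_sqrt (mul_pos hT hN).le]
      simp
      field_simp)
  refine ⟨U, ?_⟩
  ext r
  simpa using hU r

/-- The measurement results that witness non-uniformity. -/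
def pairGood (r : PairRegister N T) : Prop := r.2.1 = 0 ∧ fstWork r ≠ sndWork r

instance : DecidablePred (pairGood (N := N) (T := T)) := fun _ => instDecidableAnd

/-- The bias of a comparison of `i` with `j`. -/
def pairBias {D : Fin N → ℝ} (O : PQCOND D T) (i j : Fin N) : ℝ :=
  (∑ t, if O.label (pairSet i j) t = i then (-1 : ℝ) else 1) / T

/-- The answer to the query of the whole set. -/
def topLabel {D : Fin N → ℝ} (O : PQCOND D T) (t : Fin T) : Fin N :=
  O.label ⟨Finset.univ, univ_mem_pairQueries N⟩ t

/-- The basis states after the pair test. -/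
def pairFinal {D : Fin N → ℝ} (O : PQCOND D T) (x : Fin T × Fin N) : PairRegister N T :=
  ket (pairSet (topLabel O x.1) x.2) 0 0 x.1 (topLabel O x.1) x.2

theorem pairFinal_injective {D : Fin N → ℝ} (O : PQCOND D T) : (pairFinal O).Injective := by
  rintro ⟨t, j⟩ ⟨u, j'⟩ h
  rw [pairFinal, pairFinal, ket_inj] at h
  simp_all

variable (N T) in
/-- The pair test: three queries compare a sample of `D` with a uniform element of `[N]`. -/
theorem exists_pairTest :
    ∃ V : ∀ D : Fin N → ℝ, PQCOND D T → Matrix.unitaryGroup (PairRegister N T) ℂ,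
      Implementable 3 V ∧ ∀ D O, goodProb (pairStart N T) pairGood (V D O) =
        ∑ t : Fin T, ∑ j : Fin N, if topLabel O t ≠ j then
          pairBias O (topLabel O t) j ^ 2 / (T * N) else 0 := by
  have hT : (0 : ℝ) < T := Nat.cast_pos.2 (NeZero.pos T)
  have hN : (0 : ℝ) < N := Nat.cast_pos.2 (NeZero.pos N)
  obtain ⟨A, hA⟩ := exists_uniform_unitary T
  obtain ⟨G, hG⟩ := exists_pairInit_unitary N T
  let Q (D : Fin N → ℝ) (O : PQCOND D T) := queryUnitary O (workDim N T)
  let ph : Matrix.unitaryGroup (PairRegister N T) ℂ := signUnitary fun r => r.2.2.1 = fstWork r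
  -- The first query writes the sample `i`. `loadPair` moves it to the workspace and brings in a
  -- fresh label, a zero output and the set `{i, j}`. The next query compares, `ph` gives sign `-1`
  -- to the answer `i`, and the inverse query erases the answer so that the fresh labels can
  -- interfere under `A`. The first label and `j` remain, so different pairs of them do not
  -- interfere.
  let V (D : Fin N → ℝ) (O : PQCOND D T) : Matrix.unitaryGroup (PairRegister N T) ℂ :=
    labelUnitary A * (star (Q D O) * (ph *
      (Q D O * (mapUnitary loadPair loadPair_injective * (Q D O * G)))))
  refine ⟨V, Implementable.gate_mul (n := 3) _ (Implementable.mul (m := 1) (n := 2)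
    Implementable.star_query (Implementable.gate_mul _ (Implementable.query_mul
      (Implementable.gate_mul _ (Implementable.query_mul (Implementable.const G)))))),
    fun D O => ?_⟩
  have hV : (V D O).1.mulVec (Pi.single (pairStart N T) 1) =
      (labelUnitary A).1.mulVec ((star (Q D O)).1.mulVec (ph.1.mulVec ((Q D O).1.mulVec
        ((mapUnitary loadPair loadPair_injective).1.mulVec ((Q D O).1.mulVec
          (G.1.mulVec (Pi.single (pairStart N T) 1))))))) := by
    have : (V D O).1 = (labelUnitary A).1 * ((star (Q D O)).1 * (ph.1 *
      ((Q D O).1 * ((mapUnitary loadPair loadPair_injective).1 * ((Q D O).1 * G.1))))) := rfl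
    rw [this]
    simp only [← Matrix.mulVec_mulVec]
  have hstate : ∀ r, pairGood r → (V D O).1 r (pairStart N T) =
      superpos (pairFinal O)
        (fun x => ((pairBias O (topLabel O x.1) x.2 / √(T * N) : ℝ) : ℂ)) r := by
    intro r hr
    have hcol : (V D O).1 r (pairStart N T) =
      (V D O).1.mulVec (Pi.single (pairStart N T) 1) r := by simp
    rw [hcol, hV, hG]
    simp only [Q, star_queryUnitary]
    simp only [queryUnitary_eq, mapUnitary_mulVec_superpos, ph, signUnitary_mulVec_superpos]
    rw [labelUnitary_mulVec_superpos, Fintype.sum_prod_type, superpos_apply]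
    refine Finset.sum_congr rfl fun x _ => ?_
    simp only [Function.comp_apply, pairInit, queryStep_ket, loadPair_ket, unqueryStep_ket,
      fstWork_ket, zero_add, sub_self, hr.1, hA]
    by_cases h : r = pairFinal O x
    · rw [if_pos h, h, pairBias, Finset.sum_div, Finset.sum_div, Complex.ofReal_sum]
      refine Finset.sum_congr rfl fun t _ => ?_
      have hsq : (√T : ℂ) * (√T : ℂ) = T := by
        exact_mod_cast Real.mul_self_sqrt hT.le
      rw [if_pos ⟨rfl, rfl⟩]
      simp only [ket, topLabel]
      by_cases h2 : O.label (pairSet (O.label ⟨Finset.univ, univ_mem_pairQueries N⟩ x.1) x.2) t =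
          O.label ⟨Finset.univ, univ_mem_pairQueries N⟩ x.1
      · simp only [h2, if_true]
        push_cast
        rw [← hsq]
        field_simp
      · simp only [h2, if_false]
        push_cast
        rw [← hsq]
        field_simp
    · rw [if_neg h]
      refine Finset.sum_eq_zero fun t _ => if_neg fun h' => h ?_
      exact Prod.ext h'.1 (Prod.ext hr.1 h'.2)
  rw [goodProb, Finset.sum_congr rfl fun r _ => by
    rw [show (if pairGood r then ‖(V D O).1 r (pairStart N T)‖ ^ 2 else 0) =
      if pairGood r then ‖superpos (pairFinal O)
        (fun x => ((pairBias O (topLabel O x.1) x.2 / √(T * N) : ℝ) : ℂ)) r‖ ^ 2 else 0 from by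
          split_ifs with h
          · rw [hstate r h]
          · rfl],
    sum_normSq_superpos (pairFinal_injective O), Fintype.sum_prod_type]
  refine Finset.sum_congr rfl fun t _ => Finset.sum_congr rfl fun j _ => ?_
  have : pairGood (pairFinal O (t, j)) ↔ topLabel O t ≠ j := by
    rw [pairGood, pairFinal, fstWork_ket, sndWork_ket]
    exact and_iff_right rfl
  simp only [this]
  rw [Complex.norm_real, Real.norm_eq_abs, sq_abs, div_pow, Real.sq_sqrt (mul_pos hT hN).le]

end PairTest

/-! ### Success probability against distance from uniform -/

section Analysis

variable {N T : ℕ}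

theorem sum_topLabel {D : Fin N → ℝ} (hD : D ∈ stdSimplex ℝ (Fin N)) (hT : 0 < T) (O : PQCOND D T)
    (f : Fin N → ℝ) : ∑ t, f (topLabel O t) = ∑ i, T * D i * f i := by
  have hT' : (0 : ℝ) < T := Nat.cast_pos.2 hT
  rw [← Finset.sum_fiberwise Finset.univ (topLabel O)]
  refine Finset.sum_congr rfl fun i _ => ?_
  rw [Finset.sum_congr rfl fun t ht => by rw [(Finset.mem_filter.1 ht).2]]
  have := O.freq ⟨Finset.univ, univ_mem_pairQueries N⟩ (by simp [hD.2]) i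
  simp only [condDist, hD.2, Finset.mem_univ, if_true, div_one] at this
  rw [this, Finset.sum_const, nsmul_eq_mul, mul_div_cancel₀ _ hT'.ne']
  rfl

/-- The bias is `1 - 2q`, where `q = D i / (D i + D j)` is the frequency of the answer `i`. The
oracle guarantees this frequency because `D i > 0`. -/
theorem pairBias_eq {D : Fin N → ℝ} (hD : ∀ i, 0 ≤ D i) (hT : 0 < T) (O : PQCOND D T)
    {i j : Fin N} (hij : i ≠ j) (hi : 0 < D i) :
    pairBias O i j = (D j - D i) / (D j + D i) := by
  have hT' : (0 : ℝ) < T := Nat.cast_pos.2 hT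
  have hj := hD j
  have hS : (pairSet i j).1 = {i, j} := by simp [pairSet, hij]
  have hsum : ∑ k ∈ (pairSet i j).1, D k = D i + D j := by rw [hS, Finset.sum_pair hij]
  have hf := O.freq (pairSet i j) (by rw [hsum]; linarith) i
  rw [condDist, hsum, hS, if_pos (by simp), eq_div_iff hT'.ne'] at hf
  have hbias : ∑ t, (if O.label (pairSet i j) t = i then (-1 : ℝ) else 1) =
      T - 2 * ((Finset.univ.filter fun t => O.label (pairSet i j) t = i).card : ℝ) := by
    have : ∀ t, (if O.label (pairSet i j) t = i then (-1 : ℝ) else 1) =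
        1 - 2 * if O.label (pairSet i j) t = i then 1 else 0 := fun t => by
      split_ifs <;> norm_num
    simp only [this, Finset.sum_sub_distrib, ← Finset.mul_sum, Finset.sum_boole]
    simp
  rw [pairBias, hbias, ← hf]
  have : D i + D j ≠ 0 := by linarith
  have : D j + D i ≠ 0 := by linarith
  field_simp
  ring

theorem pairTest_prob {D : Fin N → ℝ} (hD : D ∈ stdSimplex ℝ (Fin N)) (hT : 0 < T)
    (O : PQCOND D T) :
    (∑ t : Fin T, ∑ j : Fin N, if topLabel O t ≠ j then
      pairBias O (topLabel O t) j ^ 2 / (T * N) else 0) =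
      ∑ i, ∑ j, D i / N * ((D j - D i) / (D j + D i)) ^ 2 := by
  have hT' : (0 : ℝ) < T := Nat.cast_pos.2 hT
  rw [sum_topLabel hD hT O fun i => ∑ j : Fin N, if i ≠ j then
      pairBias O i j ^ 2 / (T * N) else 0]
  refine Finset.sum_congr rfl fun i _ => ?_
  rw [Finset.mul_sum]
  refine Finset.sum_congr rfl fun j _ => ?_
  -- The diagonal is excluded by the test, and contributes zero to the formula.
  by_cases hij : i = j
  · simp [hij]
  · rw [if_pos hij]
    -- If `D i = 0` the oracle may answer arbitrarily on the pair, but `i` has weight zero.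
    rcases (hD.1 i).eq_or_lt with hi | hi
    · simp [← hi]
    · rw [pairBias_eq hD.1 hT O hij hi]
      field_simp

/-- `D i - 1 / N` is the average of `D i - D j` over `j`; apply the triangle inequality. -/
theorem l1Dist_le_sum {D : Fin N → ℝ} (hD : D ∈ stdSimplex ℝ (Fin N)) :
    l1Dist D (uniformDist N) ≤ ∑ i, ∑ j, |D j - D i| / N := by
  rw [l1Dist]
  refine Finset.sum_le_sum fun i _ => ?_
  have hN : (0 : ℝ) < N := Nat.cast_pos.2 i.pos
  have : D i - uniformDist N i = -∑ j, (D j - D i) / N := by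
    rw [← Finset.sum_div, Finset.sum_sub_distrib, hD.2, uniformDist]
    simp
    field_simp
    ring
  rw [this, abs_neg]
  refine (Finset.abs_sum_le_sum_abs _ _).trans_eq ?_
  simp [abs_div]

/-- `|D j - D i|` is `D i + D j` times the absolute bias, and by symmetry both summands contribute
equally. -/
theorem sum_abs_sub_eq {D : Fin N → ℝ} (hD : ∀ i, 0 ≤ D i) :
    ∑ i, ∑ j, |D j - D i| / N = 2 * ∑ i, ∑ j, D i / N * |(D j - D i) / (D j + D i)| := by
  have hswap : ∑ i, ∑ j, D i / N * |(D j - D i) / (D j + D i)| =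
      ∑ i, ∑ j, D j / N * |(D j - D i) / (D j + D i)| := by
    rw [Finset.sum_comm]
    refine Finset.sum_congr rfl fun i _ => Finset.sum_congr rfl fun j _ => ?_
    rw [abs_div, abs_div, abs_sub_comm, add_comm (D i)]
  rw [two_mul]
  nth_rw 2 [hswap]
  rw [← Finset.sum_add_distrib]
  refine Finset.sum_congr rfl fun i _ => ?_
  rw [← Finset.sum_add_distrib]
  refine Finset.sum_congr rfl fun j _ => ?_
  have hi := hD i
  have hj := hD j
  rcases (add_nonneg hj hi).eq_or_lt with h | h
  · have h1 : D i = 0 := by linarith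
    have h2 : D j = 0 := by linarith
    simp [h1, h2]
  · rw [abs_div, abs_of_pos h]
    field_simp
    ring

/-- Cauchy–Schwarz with the weights `D i / N`, whose total over pairs is `1`. -/
theorem sq_div_four_le_pairTest_prob {D : Fin N → ℝ} (hD : D ∈ stdSimplex ℝ (Fin N)) (hN : 0 < N)
    {ε : ℝ} (hε : 0 ≤ ε) (h : ε ≤ l1Dist D (uniformDist N)) :
    ε ^ 2 / 4 ≤ ∑ i, ∑ j, D i / N * ((D j - D i) / (D j + D i)) ^ 2 := by
  have hN' : (0 : ℝ) < N := Nat.cast_pos.2 hN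
  have h1 : ε / 2 ≤ ∑ i, ∑ j, D i / N * |(D j - D i) / (D j + D i)| := by
    linarith [l1Dist_le_sum hD, sum_abs_sub_eq hD.1]
  have hw : ∑ i, ∑ _j : Fin N, D i / N = 1 := by
    rw [← hD.2]
    refine Finset.sum_congr rfl fun i _ => ?_
    simp
    field_simp
  have hcs := Finset.sum_sq_le_sum_mul_sum_of_sq_le_mul (Finset.univ : Finset (Fin N × Fin N))
    (r := fun x => D x.1 / N * |(D x.2 - D x.1) / (D x.2 + D x.1)|)
    (f := fun x => D x.1 / N)
    (g := fun x => D x.1 / N * ((D x.2 - D x.1) / (D x.2 + D x.1)) ^ 2)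
    (fun x _ => div_nonneg (hD.1 _) hN'.le)
    (fun x _ => mul_nonneg (div_nonneg (hD.1 _) hN'.le) (sq_nonneg _))
    (fun x _ => le_of_eq (by rw [mul_pow, sq_abs]; ring))
  simp only [Fintype.sum_prod_type, hw, one_mul] at hcs
  nlinarith

theorem pairTest_prob_uniform {D : Fin N → ℝ} (h : l1Dist D (uniformDist N) = 0) :
    ∑ i, ∑ j, D i / N * ((D j - D i) / (D j + D i)) ^ 2 = 0 := by
  have hD : ∀ i, D i = 1 / N := fun i => by
    have := (Finset.sum_eq_zero_iff_of_nonneg fun i _ => abs_nonneg _).1 h i (Finset.mem_univ i)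
    exact sub_eq_zero.1 (abs_eq_zero.1 this)
  simp [hD]

theorem l1Dist_le_two {D : Fin N → ℝ} (hD : D ∈ stdSimplex ℝ (Fin N)) (hN : 0 < N) :
    l1Dist D (uniformDist N) ≤ 2 := by
  have hN' : (0 : ℝ) < N := Nat.cast_pos.2 hN
  calc l1Dist D (uniformDist N) ≤ ∑ i, (D i + 1 / N) := Finset.sum_le_sum fun i _ => by
        have := hD.1 i
        have : 0 < 1 / (N : ℝ) := by positivity
        rw [uniformDist, abs_le]
        constructor <;> linarith
    _ = 2 := by
        rw [Finset.sum_add_distrib, hD.2]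
        simp [hN'.ne']
        norm_num

end Analysis

/-! ### Schedule of amplification depths -/

section Schedule

variable {N T W : ℕ} {𝒬 : Finset (Finset (Fin N))}

/-- The circuits `gate k` with `3 ^ k * q` queries, for `k ≤ K`, each of them four times. -/
def schedule (q : ℕ) (gate : ℕ → ℕ → Matrix.unitaryGroup (Register 𝒬 T W) ℂ) :
    ℕ → List (ℕ × (ℕ → Matrix.unitaryGroup (Register 𝒬 T W) ℂ))
  | 0 => []
  | k + 1 => List.replicate 4 (3 ^ k * q, gate k) ++ schedule q gate k

theorem schedule_queries (q : ℕ) (gate : ℕ → ℕ → Matrix.unitaryGroup (Register 𝒬 T W) ℂ)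
    (K : ℕ) : ((schedule q gate K).map Prod.fst).sum ≤ 2 * 3 ^ K * q := by
  induction K with
  | zero => simp [schedule]
  | succ K ih =>
    simp only [schedule, List.map_append, List.sum_append, List.map_replicate, List.sum_replicate,
      smul_eq_mul]
    calc _ ≤ 4 * (3 ^ K * q) + 2 * 3 ^ K * q := Nat.add_le_add_left ih _
      _ = _ := by ring

theorem missProb_schedule {D : Fin N → ℝ} (O : CondOracle 𝒬 D T) (s : Register 𝒬 T W)
    (good : Register 𝒬 T W → Prop) [DecidablePred good] (q : ℕ)
    (gate : ℕ → ℕ → Matrix.unitaryGroup (Register 𝒬 T W) ℂ) (K : ℕ) :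
    missProb O s good (schedule q gate K) =
      ∏ k ∈ Finset.range K, (1 - goodProb s good (circuitUnitary O (gate k) (3 ^ k * q))) ^ 4 := by
  induction K with
  | zero => simp [schedule, missProb]
  | succ K ih =>
    rw [Finset.prod_range_succ, ← ih]
    simp only [schedule, missProb, List.map_append, List.prod_append, List.map_replicate,
      List.prod_replicate]
    ring

theorem exists_three_pow_mul {ε : ℝ} (hε : 0 < ε) (hε2 : ε ≤ 2) :
    ∃ K : ℕ, 2 ≤ 3 ^ K * ε ∧ 3 ^ K ≤ 6 / ε := by
  obtain ⟨n, h1, h2⟩ := exists_nat_pow_near (x := 2 / ε) (y := 3)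
    ((one_le_div hε).2 hε2) (by norm_num)
  refine ⟨n + 1, ((div_lt_iff₀ hε).1 h2).le, ?_⟩
  rw [pow_succ]
  calc (3 : ℝ) ^ n * 3 ≤ 2 / ε * 3 := by gcongr
    _ = 6 / ε := by ring

end Schedule

end QuantumTesting

end

theorem mainTheorem2 :
    ∃ (C : ℝ) (k : ℕ), ∀ (N T : ℕ) (ε : ℝ), 1 ≤ N → 1 ≤ T → 0 < ε →
      ∃ A : QuantumTesting.QueryAlgorithm (QuantumTesting.pairQueries N) T QuantumTesting.Verdict,
        (A.queries : ℝ) ≤ C * ((1 / ε) * Real.log (2 + 1 / ε) ^ k) ∧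
        ∀ D ∈ stdSimplex ℝ (Fin N), ∀ O : QuantumTesting.PQCOND D T,
          (QuantumTesting.l1Dist D (QuantumTesting.uniformDist N) = 0 →
            2 / 3 ≤ A.outputProb O QuantumTesting.Verdict.uniform) ∧
          (ε ≤ QuantumTesting.l1Dist D (QuantumTesting.uniformDist N) →
            2 / 3 ≤ A.outputProb O QuantumTesting.Verdict.far) := by
  open QuantumTesting in
  -- `108 = 18 * 6`: the schedule makes at most `18 * 3 ^ K` queries, and `3 ^ K ≤ 6 / ε`. The
  -- exponent `0` means that no logarithm is needed.
  refine ⟨108, 0, fun N T ε hN hT hε => ?_⟩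
  have : NeZero N := ⟨by omega⟩
  have : NeZero T := ⟨by omega⟩
  -- No distribution is at distance more than `2`, so the far case is then vacuous.
  by_cases hε2 : 2 < ε
  · refine ⟨.answer .uniform, ?_, fun D hD O => ⟨fun _ => ?_, fun h => ?_⟩⟩
    · simp [QueryAlgorithm.queries]
      positivity
    · norm_num [QueryAlgorithm.outputProb]
    · linarith [l1Dist_le_two hD hN]
  obtain ⟨K, hK1, hK2⟩ := exists_three_pow_mul hε (not_lt.1 hε2)
  obtain ⟨V, hV, hprob⟩ := exists_pairTest N T
  choose gate hgate using fun k => hV.amplify_iterate (pairStart N T) pairGood k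
  -- The argument `K + 1` runs the depths `0, …, K`; the `3` is the cost of one pair test.
  refine ⟨detect (pairStart N T) pairGood (schedule 3 gate (K + 1)), ?_, fun D hD O => ?_⟩
  · have h := (detect_queries (pairStart N T) pairGood (schedule 3 gate (K + 1))).trans
      (schedule_queries 3 gate (K + 1))
    calc ((detect (pairStart N T) pairGood (schedule 3 gate (K + 1))).queries : ℝ)
        ≤ ((2 * 3 ^ (K + 1) * 3 : ℕ) : ℝ) := Nat.cast_le.2 h
      _ = 18 * 3 ^ K := by push_cast; ring
      _ ≤ 18 * (6 / ε) := by gcongr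
      _ = _ := by ring
  · rw [(detect_outputProb O _ _ _).1, (detect_outputProb O _ _ _).2, missProb_schedule]
    simp only [← hgate]
    have hp := hprob D O
    rw [pairTest_prob hD hT O] at hp
    constructor
    · intro h
      rw [pairTest_prob_uniform h] at hp
      have : ∀ k, goodProb (pairStart N T) pairGood
          ((amplify (pairStart N T) pairGood)^[k] (V D O)) = 0 := fun k => by
        rw [goodProb_amplify_iterate (θ := 0) _ _ _ (by simpa using hp)]
        simp
      simp only [this]
      norm_num
    · intro h
      obtain ⟨k, hk, hgood⟩ := exists_goodProb_amplify_iterate (pairStart N T) pairGood (V D O) hε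
        (hp ▸ sq_div_four_le_pairTest_prob hD hN hε.le h) hK1
      have h0 : ∀ k, 0 ≤ 1 - goodProb (pairStart N T) pairGood
          ((amplify (pairStart N T) pairGood)^[k] (V D O)) := fun k =>
        sub_nonneg.2 (goodProb_le_one _ _ _)
      have hle : ∀ k, 1 - goodProb (pairStart N T) pairGood
          ((amplify (pairStart N T) pairGood)^[k] (V D O)) ≤ 1 := fun k =>
        sub_le_self _ (goodProb_nonneg _ _ _)
      -- The good depth alone makes the miss probability at most `(3 / 4) ^ 4 = 81 / 256 < 1 / 3`;
      -- the other factors are at most `1`.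
      rw [← Finset.mul_prod_erase _ _ (Finset.mem_range.2 (Nat.lt_succ_of_le hk))]
      have h1 := Finset.prod_le_one (s := (Finset.range (K + 1)).erase k)
        (fun i _ => pow_nonneg (h0 i) 4) (fun i _ => pow_le_one₀ (n := 4) (h0 i) (hle i))
      have h2 : (1 - goodProb (pairStart N T) pairGood
          ((amplify (pairStart N T) pairGood)^[k] (V D O))) ^ 4 ≤ (3 / 4) ^ 4 :=
        pow_le_pow_left₀ (h0 k) (by linarith) 4
      have h3 := mul_le_mul h2 h1 (Finset.prod_nonneg fun i _ => pow_nonneg (h0 i) 4) (by norm_num)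
      norm_num at h3 ⊢
      linarith
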